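/- On $L^2(\mathbb R)$ let $\mathsf q$ be multiplication by $x$ and $\mathsf p=\frac1{2\pi \mathsf i}\frac{d}{dx}$ (self-adjoint, $[\mathsf p,\mathsf q]=(2\pi\mathsf i)^{-1}$). Write $\langle x|f\rangle=f(x)$ for the position and $(x|f)=\int_{\mathbb R}e^{-2\pi\mathsf i xy}f(y)\,dy$ for the momentum wave function of $f\in L^2(\mathbb R)$. Put $$\mathsf V= e^{-\pi\mathsf i/3}\,e^{2\pi\mathsf i\mathsf p^2}e^{\pi\mathsf i\mathsf q^2}e^{\pi\mathsf i\mathsf p^2},$$ and let $\mathsf F$ be the operator $(\mathsf Ff)(x)=\int_{\mathbb R} e^{2\pi\mathsf i xy}f(y)\,dy$. For $\mathsf b>0$ let $\mathsf x,\mathsf y$ be either $$\mathsf x=2\pi\mathsf b\,\tfrac{2\mathsf p+\mathsf q}{3},\quad \mathsf y=-2\pi\mathsf b\,\tfrac{\mathsf p+2\mathsf q}{3}\qquad\text{or}\qquad \mathsf x=2\pi\mathsf b\,\mathsf q,\quad \mathsf y=2\pi\mathsf b\,\mathsf p,$$ so that $[\mathsf x,\mathsf y]=\mathsf i\hbar$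 with $\hbar=2\pi\mathsf b^2/3$, respectively $\hbar=2\pi\mathsf b^2$. Let $\mathsf O_{1,1}=e^{\mathsf x}+e^{\mathsf y}+e^{-\mathsf x-\mathsf y}$ be the form sum of the three positive self-adjoint operators, that is, the operator of the quadratic form $\|e^{\mathsf x/2}f\|^2+\|e^{\mathsf y/2}f\|^2+\|e^{-(\mathsf x+\mathsf y)/2}f\|^2$ on the intersection of the three form domains. Then: 1. $\mathsf V$ is unitary, has order exactly three, and $\mathsf V=e^{-\pi\mathsf i/12}e^{\pi\mathsf i\mathsf p^2}\mathsf F$, where $\langle x|\mathsf F|y\rangle=e^{2\pi\mathsf i xy}=(x|\mathsf F|y)$. 2. $\mathsf V$ has the kernels $$\langle x|\mathsf V|y\rangle=e^{-\pi\mathsf i/12}e^{\pi\mathsf i(2x+y)y}=(y|\mathsf V|x),\quad \langle x|\mathsf V|y)=e^{\pi\mathsf i/6}e^{-\pi\mathsf i(x+y)^2},\quad (x|\mathsf V|y\rangle=e^{-\pi\mathsf i/12}e^{\pi\mathsf i x^2}\delta(x-y).$$ (A kernel that is a function acts by $\int K(x,y)f(y)\,dy$ on $f\in L^1\cap L^2$,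 for almost every $x$; a kernel $k(x)\delta(x-y)$ denotes multiplication by $k$ on $L^2$.) 3. For every $\mathsf b>0$ and either choice of $\mathsf x,\mathsf y$, the operator $\mathsf O_{1,1}$ is densely defined and injective, and $\mathsf V$ commutes with $\mathsf O_{1,1}$ and with its inverse $\rho_{1,1}=\mathsf O_{1,1}^{-1}$, domains included. Likewise $\mathsf V$ commutes with the algebraic sum $e^{\mathsf x}+e^{\mathsf y}+e^{-\mathsf x-\mathsf y}$ on the intersection of the domains of its three terms. -/

import Mathlib

open MeasureTheory FourierTransform
open scoped ENNReal InnerProductSpace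

noncomputable section

/-- The Hilbert space `L²(ℝ)`. An element `f` is the position wave function `x ↦ ⟨x|f⟩`. -/
abbrev L2R : Type := Lp ℂ 2 (volume : Measure ℝ)

/-- The passage from the position to the momentum wave function: `(x|f) = ∫ e^{-2πixy} ⟨y|f⟩ dy`,
the unitary Fourier transform of `L²(ℝ)`. -/
def toMomentum : L2R ≃ₗᵢ[ℂ] L2R := Lp.fourierTransformₗᵢ ℝ ℂ

/-! ### Multiplication by the chirp `e^{πitx²}` -/

/-- The function `x ↦ e^{πitx²}`. -/
def chirp (t x : ℝ) : ℂ := Complex.exp ((Real.pi * t * x ^ 2 : ℝ) * Complex.I)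

theorem norm_chirp (t x : ℝ) : ‖chirp t x‖ = 1 := Complex.norm_exp_ofReal_mul_I _

theorem chirp_neg_mul (t x : ℝ) : chirp (-t) x * chirp t x = 1 := by
  unfold chirp
  rw [← Complex.exp_add]
  push_cast
  ring_nf
  exact Complex.exp_zero

theorem continuous_chirp (t : ℝ) : Continuous (chirp t) := by
  unfold chirp
  fun_prop

theorem memLp_chirp (t : ℝ) (f : L2R) : MemLp (fun x => chirp t x * f x) 2 volume := by
  refine (Lp.memLp f).of_le ?_ (Filter.Eventually.of_forall fun x => ?_)
  · exact (continuous_chirp t).aestronglyMeasurable.mul (Lp.aestronglyMeasurable f)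
  · rw [norm_mul, norm_chirp, one_mul]

theorem chirp_cancel (t : ℝ) (f : L2R) :
    (memLp_chirp (-t) ((memLp_chirp t f).toLp _)).toLp _ = f := by
  apply Lp.ext
  filter_upwards [(memLp_chirp (-t) ((memLp_chirp t f).toLp _)).coeFn_toLp,
    (memLp_chirp t f).coeFn_toLp] with x h1 h2
  rw [h1, h2, ← mul_assoc, chirp_neg_mul, one_mul]

/-- The unitary operator `e^{πitq²}`: multiplication of position wave functions by `e^{πitx²}`. -/
def gaussQ (t : ℝ) : L2R ≃ₗᵢ[ℂ] L2R where
  toFun f := (memLp_chirp t f).toLp _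
  invFun f := (memLp_chirp (-t) f).toLp _
  map_add' f g := by
    apply Lp.ext
    filter_upwards [(memLp_chirp t (f + g)).coeFn_toLp, (memLp_chirp t f).coeFn_toLp,
      (memLp_chirp t g).coeFn_toLp, Lp.coeFn_add f g,
      Lp.coeFn_add ((memLp_chirp t f).toLp _) ((memLp_chirp t g).toLp _)] with x h1 h2 h3 h4 h5
    rw [h1, h5, Pi.add_apply, h2, h3, h4, Pi.add_apply, mul_add]
  map_smul' c f := by
    apply Lp.ext
    filter_upwards [(memLp_chirp t (c • f)).coeFn_toLp, (memLp_chirp t f).coeFn_toLp,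
      Lp.coeFn_smul c f, Lp.coeFn_smul c ((memLp_chirp t f).toLp _)] with x h1 h2 h3 h4
    simp only [RingHom.id_apply]
    rw [h1, h4, Pi.smul_apply, h2, h3, Pi.smul_apply, smul_eq_mul, smul_eq_mul]
    ring
  left_inv f := chirp_cancel t f
  right_inv f := by
    simpa using chirp_cancel (-t) f
  norm_map' f := by
    have h : ∀ᵐ x, ‖(memLp_chirp t f).toLp _ x‖ = ‖f x‖ := by
      filter_upwards [(memLp_chirp t f).coeFn_toLp] with x h1
      rw [h1, norm_mul, norm_chirp, one_mul]
    exact le_antisymm (Lp.norm_le_norm_of_ae_le (h.mono fun _ hx => hx.le))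
      (Lp.norm_le_norm_of_ae_le (h.mono fun _ hx => hx.ge))

/-- The unitary operator `e^{πitp²}`: multiplication of momentum wave functions by `e^{πitx²}`. -/
def gaussP (t : ℝ) : L2R ≃ₗᵢ[ℂ] L2R :=
  (toMomentum.trans (gaussQ t)).trans toMomentum.symm

/-- The Fourier operator `F`, `(F f)(x) = ∫ e^{2πixy} f(y) dy`. -/
def fourierOp : L2R →L[ℂ] L2R := (toMomentum.symm : L2R →L[ℂ] L2R)

/-- `V = e^{-πi/3} e^{2πip²} e^{πiq²} e^{πip²}`. -/
def opV : L2R →L[ℂ] L2R :=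
  Complex.exp (-(Real.pi * Complex.I / 3)) •
    ((gaussP 2 : L2R →L[ℂ] L2R) ∘L (gaussQ 1 : L2R →L[ℂ] L2R) ∘L (gaussP 1 : L2R →L[ℂ] L2R))

/-! ### Integral kernels -/

/-- The operator `T` has the integral kernel `K`: `(T f)(x) = ∫ K(x,y) f(y) dy` for almost every
`x`, for all `f ∈ L¹ ∩ L²`. -/
def HasIntegralKernel (T : L2R →L[ℂ] L2R) (K : ℝ → ℝ → ℂ) : Prop :=
  ∀ f : L2R, Integrable f volume →
    ∀ᵐ x : ℝ, Integrable (fun y => K x y * f y) volume ∧ T f x = ∫ y, K x y * f y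

/-- The operator `T` has the distributional kernel `k(x) δ(x - y)`: it is the multiplication
operator by `k`. -/
def HasDiagonalKernel (T : L2R →L[ℂ] L2R) (k : ℝ → ℂ) : Prop :=
  ∀ f : L2R, ∀ᵐ x : ℝ, T f x = k x * f x

/-- The operator whose kernel is `(x|T|y⟩`. -/
def momPos (T : L2R →L[ℂ] L2R) : L2R →L[ℂ] L2R := (toMomentum : L2R →L[ℂ] L2R) ∘L T

/-- The operator whose kernel is `⟨x|T|y)`. -/
def posMom (T : L2R →L[ℂ] L2R) : L2R →L[ℂ] L2R := T ∘L (toMomentum.symm : L2R →L[ℂ] L2R)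

/-- The operator whose kernel is `(x|T|y)`. -/
def momMom (T : L2R →L[ℂ] L2R) : L2R →L[ℂ] L2R :=
  (toMomentum : L2R →L[ℂ] L2R) ∘L T ∘L (toMomentum.symm : L2R →L[ℂ] L2R)

/-! ### Functions of the Heisenberg operators `aq + bp`, and three-term operators -/

theorem mul_add_ae (φ : ℝ → ℂ) (f g : L2R) : (fun x => φ x * (f + g : L2R) x) =ᵐ[volume]
    (fun x => φ x * f x) + fun x => φ x * g x := by
  filter_upwards [Lp.coeFn_add f g] with x hx
  rw [hx, Pi.add_apply, Pi.add_apply, mul_add]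

theorem mul_smul_ae (φ : ℝ → ℂ) (c : ℂ) (f : L2R) :
    (fun x => φ x * (c • f : L2R) x) =ᵐ[volume] c • fun x => φ x * f x := by
  filter_upwards [Lp.coeFn_smul c f] with x hx
  rw [hx, Pi.smul_apply, Pi.smul_apply, smul_eq_mul, smul_eq_mul, mul_left_comm]

/-- The maximal domain `{f ∈ L² | φ f ∈ L²}` of the multiplication by `φ`. -/
def mulDomain (φ : ℝ → ℂ) : Submodule ℂ L2R where
  carrier := {f | MemLp (fun x => φ x * f x) 2 volume}
  zero_mem' := by
    have h : (fun x => φ x * (0 : L2R) x) =ᵐ[volume] 0 := by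
      filter_upwards [Lp.coeFn_zero ℂ 2 (volume : Measure ℝ)] with x hx
      rw [hx, Pi.zero_apply, mul_zero]
    exact (memLp_congr_ae h).2 MemLp.zero
  add_mem' {f g} hf hg := (memLp_congr_ae (mul_add_ae φ f g)).2 (MemLp.add hf hg)
  smul_mem' c f hf := (memLp_congr_ae (mul_smul_ae φ c f)).2 (MemLp.const_smul hf c)

theorem toLp_mul_add (φ : ℝ → ℂ) (f g : L2R) (hf : MemLp (fun x => φ x * f x) 2 volume)
    (hg : MemLp (fun x => φ x * g x) 2 volume)
    (hfg : MemLp (fun x => φ x * (f + g : L2R) x) 2 volume) :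
    hfg.toLp _ = hf.toLp _ + hg.toLp _ := by
  apply Lp.ext
  filter_upwards [hfg.coeFn_toLp, hf.coeFn_toLp, hg.coeFn_toLp, mul_add_ae φ f g,
    Lp.coeFn_add (hf.toLp _) (hg.toLp _)] with x h1 h2 h3 h4 h5
  rw [h1, h4, h5, Pi.add_apply, Pi.add_apply, h2, h3]

theorem toLp_mul_smul (φ : ℝ → ℂ) (c : ℂ) (f : L2R) (hf : MemLp (fun x => φ x * f x) 2 volume)
    (hcf : MemLp (fun x => φ x * (c • f : L2R) x) 2 volume) :
    hcf.toLp _ = c • hf.toLp _ := by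
  apply Lp.ext
  filter_upwards [hcf.coeFn_toLp, hf.coeFn_toLp, mul_smul_ae φ c f,
    Lp.coeFn_smul c (hf.toLp _)] with x h1 h2 h3 h4
  rw [h1, h3, h4, Pi.smul_apply, Pi.smul_apply, h2]

/-- Multiplication by `φ` with its maximal domain. -/
def mulOp (φ : ℝ → ℂ) : L2R →ₗ.[ℂ] L2R where
  domain := mulDomain φ
  toFun :=
    { toFun := fun f => MemLp.toLp (fun x => φ x * (f : L2R) x) f.2
      map_add' := by
        rintro ⟨f, hf⟩ ⟨g, hg⟩
        exact toLp_mul_add φ f g hf hg ((mulDomain φ).add_mem hf hg)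
      map_smul' := by
        rintro c ⟨f, hf⟩
        rw [RingHom.id_apply]
        exact toLp_mul_smul φ c f hf ((mulDomain φ).smul_mem c hf) }

/-- `U⁻¹ φ U`, where `φ` acts by multiplication with its maximal domain. -/
def conjMul (U : L2R ≃ₗᵢ[ℂ] L2R) (φ : ℝ → ℂ) : L2R →ₗ.[ℂ] L2R where
  domain := (mulOp φ).domain.comap U.toLinearEquiv.toLinearMap
  toFun :=
    { toFun := fun f => U.symm (mulOp φ ⟨U f, f.2⟩)
      map_add' := fun f g => by
        rw [← map_add, ← LinearPMap.map_add]
        congr 2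
        exact Subtype.ext (map_add U (f : L2R) g)
      map_smul' := fun c f => by
        rw [RingHom.id_apply, ← map_smul, ← LinearPMap.map_smul]
        congr 2
        exact Subtype.ext (map_smul U c (f : L2R)) }

open Classical in
/-- A unitary `U` that diagonalizes `c.1 q + c.2 p`. With `G = e^{πi(c.1/c.2)q²}` one has
`p + (c.1/c.2) q = G⁻¹ p G`, so that for `c.2 ≠ 0` the operator `c.1 q + c.2 p` is
`G⁻¹ (c.2 p) G`. -/
def heisUnitary (c : ℝ × ℝ) : L2R ≃ₗᵢ[ℂ] L2R :=
  if c.2 = 0 then LinearIsometryEquiv.refl ℂ L2R else (gaussQ (c.1 / c.2)).trans toMomentum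

open Classical in
/-- `U (c.1 q + c.2 p) U⁻¹` is multiplication by this function, where `U = heisUnitary c`. -/
def heisSymbol (c : ℝ × ℝ) (x : ℝ) : ℝ := if c.2 = 0 then c.1 * x else c.2 * x

/-- The positive self-adjoint operator `e^{c.1 q + c.2 p}`. -/
def expHeis (c : ℝ × ℝ) : L2R →ₗ.[ℂ] L2R :=
  conjMul (heisUnitary c) fun x => (Real.exp (heisSymbol c x) : ℂ)

/-- For closed operators `A 0, A 1, A 2`, the graph of the self-adjoint operator of the quadratic
form `∑ i, ‖A i f‖²` with domain `⋂ i, D(A i)`. -/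
def formGraph (A : Fin 3 → L2R →ₗ.[ℂ] L2R) : Submodule ℂ (L2R × L2R) where
  carrier := {w | ∃ hf : ∀ i, w.1 ∈ (A i).domain, ∀ (g : L2R) (hg : ∀ i, g ∈ (A i).domain),
    ∑ i, ⟪A i ⟨g, hg i⟩, A i ⟨w.1, hf i⟩⟫_ℂ = ⟪g, w.2⟫_ℂ}
  zero_mem' := by
    refine ⟨fun i => (A i).domain.zero_mem, fun g hg => ?_⟩
    have h (i : Fin 3) : A i ⟨(0 : L2R × L2R).1, (A i).domain.zero_mem⟩ = 0 := (A i).map_zero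
    simp only [h, inner_zero_right, Finset.sum_const_zero, Prod.snd_zero]
  add_mem' := by
    rintro v w ⟨hv, hv'⟩ ⟨hw, hw'⟩
    refine ⟨fun i => (A i).domain.add_mem (hv i) (hw i), fun g hg => ?_⟩
    have h (i : Fin 3) : A i ⟨(v + w).1, (A i).domain.add_mem (hv i) (hw i)⟩ =
        A i ⟨v.1, hv i⟩ + A i ⟨w.1, hw i⟩ := (A i).map_add ⟨v.1, hv i⟩ ⟨w.1, hw i⟩
    simp only [h, inner_add_right, Finset.sum_add_distrib, Prod.snd_add]
    rw [hv' g hg, hw' g hg]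
  smul_mem' := by
    rintro c v ⟨hv, hv'⟩
    refine ⟨fun i => (A i).domain.smul_mem c (hv i), fun g hg => ?_⟩
    have h (i : Fin 3) : A i ⟨(c • v).1, (A i).domain.smul_mem c (hv i)⟩ =
        c • A i ⟨v.1, hv i⟩ := (A i).map_smul c ⟨v.1, hv i⟩
    simp only [h, inner_smul_right, ← Finset.mul_sum, Prod.smul_snd]
    rw [hv' g hg]

/-- The three terms `x`, `y`, `-mx - ny`, each given by its coefficients with respect to
`(q, p)`. -/
def threeTerms (m n : ℝ) (x y : ℝ × ℝ) : Fin 3 → ℝ × ℝ := ![x, y, -(m • x) - n • y]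

/-- The operator `O_{m,n} = e^x + e^y + e^{-mx-ny}` as a form sum: the self-adjoint operator of
the quadratic form `‖e^{x/2} f‖² + ‖e^{y/2} f‖² + ‖e^{(-mx-ny)/2} f‖²`. -/
def threeTermOp (m n : ℝ) (x y : ℝ × ℝ) : L2R →ₗ.[ℂ] L2R :=
  (formGraph fun i => expHeis ((1 / 2 : ℝ) • threeTerms m n x y i)).toLinearPMap

/-- The algebraic sum `e^x + e^y + e^{-mx-ny}`, with domain the intersection of the three
domains. -/
def threeTermSum (m n : ℝ) (x y : ℝ × ℝ) : L2R →ₗ.[ℂ] L2R :=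
  expHeis (threeTerms m n x y 0) + expHeis (threeTerms m n x y 1) +
    expHeis (threeTerms m n x y 2)

/-- The inverse `ρ_{m,n} = O_{m,n}⁻¹`. -/
def rhoOp (m n : ℝ) (x y : ℝ × ℝ) : L2R →ₗ.[ℂ] L2R := (threeTermOp m n x y).inverse

/-- The bounded invertible operator `V` commutes with the partially defined operator `T`, that is
`V T = T V`, the domains included. -/
def CommutesWith (V : L2R →L[ℂ] L2R) (T : L2R →ₗ.[ℂ] L2R) : Prop :=
  (∀ f : L2R, V f ∈ T.domain ↔ f ∈ T.domain) ∧
    ∀ (f : T.domain) (h : V f ∈ T.domain), T ⟨V f, h⟩ = V (T f)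

/-- The pairs of Heisenberg operators `(x, y)` in which `O_{1,1}` is realized on `L²(ℝ)`, as
coefficients with respect to `(q, p)`: either `x = 2πb (2p + q)/3`, `y = -2πb (p + 2q)/3`, with
`ħ = 2πb²/3`, or `x = 2πb q`, `y = 2πb p`, with `ħ = 2πb²`. -/
def IsRealization (b : ℝ) (x y : ℝ × ℝ) : Prop :=
  (x = (2 * Real.pi * b) • ((1 / 3 : ℝ), (2 / 3 : ℝ)) ∧
      y = (2 * Real.pi * b) • ((-2 / 3 : ℝ), (-1 / 3 : ℝ))) ∨
    (x = (2 * Real.pi * b) • ((1 : ℝ), (0 : ℝ)) ∧ y = (2 * Real.pi * b) • ((0 : ℝ), (1 : ℝ)))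

end

noncomputable section

/-! ### The Fourier transform on `L¹ ∩ L²` -/

/-! Write `𝓕` for `toMomentum` and `G t` for multiplication by `e^{πitx²}`, so that `gaussP t = 𝓕⁻¹
(G t) 𝓕`. Everything about `V` rests on the Fresnel integral (`gaussP_eq`), which for `t = 1` reads
`𝓕⁻¹ (G 1) 𝓕 = e^{πi/4} (G (-1)) 𝓕⁻¹ (G (-1))`. Inserted into the definition of `V`, it cancels the
inner factors and leaves `V = e^{-πi/12} 𝓕⁻¹ (G 1)` (`opV_apply`). Unitarity and the kernels are
read off from this form; a second use of the identity gives `V³ = 1`.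

Conjugation by `V` acts on the operators `aq + bp` by the matrix of order three `heisRot`, that is
`q ↦ p ↦ -p - q ↦ q`. In both realizations it permutes `x`, `y`, `-x - y` cyclically. Since
functional calculus is realized concretely as multiplication after a unitary, the statement for
exponentials becomes an intertwining relation between the diagonalizing unitaries
(`mem_graph_conjMul_iff_of_intertwine`, `mem_graph_expHeis_heisRot`).

A unitary that permutes the three terms preserves both the algebraic sum and the quadratic form,
hence the operator of the form (`formGraph_map`). Density of its domain follows by solving `(1 + O)
f = h` with an orthogonal projection (`exists_mem_formGraph_sub`), once the form domain is known to
be total; it contains all modulated Gaussians, which are total (`eq_zero_of_inner_gaussianVec`). -/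

theorem L2R.locallyIntegrable (f : L2R) : LocallyIntegrable f volume :=
  (Lp.memLp f).locallyIntegrable (by norm_num)

theorem integral_mul_fourier (g f : ℝ → ℂ) (hg : Integrable g) (hf : Integrable f) :
    ∫ ξ, 𝓕 g ξ * f ξ = ∫ x, g x * 𝓕 f x := by
  simpa using! VectorFourier.integral_fourierIntegral_smul_eq_flip (L := innerₗ ℝ)
      Real.continuous_fourierChar continuous_inner hg hf

theorem continuous_fourier_of_integrable {f : ℝ → ℂ} (hf : Integrable f) : Continuous (𝓕 f) :=
  VectorFourier.fourierIntegral_continuous Real.continuous_fourierChar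
    (L := innerₗ ℝ) continuous_inner hf

/-- Both sides agree when integrated against smooth compactly supported functions: the left by
compatibility with the Fourier transform of tempered distributions, the right by the multiplication
formula. -/
theorem toMomentum_ae_eq (f : L2R) (hf : Integrable f volume) :
    toMomentum f =ᵐ[volume] 𝓕 (f : ℝ → ℂ) := by
  refine ae_eq_of_integral_contDiff_smul_eq (L2R.locallyIntegrable _)
    (continuous_fourier_of_integrable hf).locallyIntegrable fun g hg hg' => ?_
  let G : SchwartzMap ℝ ℂ := HasCompactSupport.toSchwartzMap (f := fun x => (g x : ℂ))
    (hg'.comp_left (g := fun x : ℝ => (x : ℂ)) Complex.ofReal_zero)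
    (Complex.ofRealCLM.contDiff.comp hg)
  have hG (x : ℝ) : G x = (g x : ℂ) := rfl
  have h := congrArg (fun T => T G) (Lp.fourier_toTemperedDistribution_eq f)
  simp only [TemperedDistribution.fourier_apply, Lp.toTemperedDistribution_apply,
    SchwartzMap.fourier_coe, smul_eq_mul] at h
  rw [integral_mul_fourier _ _ G.integrable hf] at h
  simpa only [hG, Complex.real_smul] using! h.symm

/-! ### Dilations, chirps and parity on `L²(ℝ)` -/

theorem quasiMeasurePreserving_const_mul {a : ℝ} (ha : a ≠ 0) :
    Measure.QuasiMeasurePreserving (fun x : ℝ => a * x) volume volume :=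
  Measure.quasiMeasurePreserving_smul volume ha

theorem eLpNorm_comp_const_mul {a : ℝ} (ha : a ≠ 0) {f : ℝ → ℂ}
    (hf : AEStronglyMeasurable f volume) :
    eLpNorm (fun x => f (a * x)) 2 volume =
      ENNReal.ofReal |a⁻¹| ^ (1 / 2 : ℝ) * eLpNorm f 2 volume := by
  have h : ENNReal.ofReal |a⁻¹| ≠ 0 := by simpa using ha
  have := eLpNorm_map_measure (g := f) (f := fun x : ℝ => a * x) (μ := volume) (p := 2)
    (by rw [Real.map_volume_mul_left ha]; exact hf.smul_measure _)
    (measurable_const_mul a).aemeasurable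
  rw [Real.map_volume_mul_left ha, eLpNorm_smul_measure_of_ne_zero h] at this
  rw [show (fun x => f (a * x)) = f ∘ (fun x => a * x) from rfl, ← this, smul_eq_mul]
  norm_num

theorem memLp_comp_const_mul {a : ℝ} (ha : a ≠ 0) (f : L2R) :
    MemLp (fun x => f (a * x)) 2 volume := by
  have hf := Lp.aestronglyMeasurable f
  refine ⟨hf.comp_quasiMeasurePreserving (quasiMeasurePreserving_const_mul ha), ?_⟩
  rw [eLpNorm_comp_const_mul ha hf]
  exact ENNReal.mul_lt_top (by finiteness) (Lp.memLp f).2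

/-- The dilation `f ↦ f(a ·)`. -/
def dilation (a : ℝ) (ha : a ≠ 0) : L2R →L[ℂ] L2R :=
  LinearMap.mkContinuous
    { toFun f := (memLp_comp_const_mul ha f).toLp _
      map_add' f g := by
        apply Lp.ext
        filter_upwards [(memLp_comp_const_mul ha (f + g)).coeFn_toLp,
          (memLp_comp_const_mul ha f).coeFn_toLp, (memLp_comp_const_mul ha g).coeFn_toLp,
          (quasiMeasurePreserving_const_mul ha).ae (Lp.coeFn_add f g),
          Lp.coeFn_add ((memLp_comp_const_mul ha f).toLp _)
            ((memLp_comp_const_mul ha g).toLp _)] with x h1 h2 h3 h4 h5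
        rw [h1, h5, Pi.add_apply, h2, h3, h4, Pi.add_apply]
      map_smul' c f := by
        apply Lp.ext
        filter_upwards [(memLp_comp_const_mul ha (c • f)).coeFn_toLp,
          (memLp_comp_const_mul ha f).coeFn_toLp,
          (quasiMeasurePreserving_const_mul ha).ae (Lp.coeFn_smul c f),
          Lp.coeFn_smul c ((memLp_comp_const_mul ha f).toLp _)] with x h1 h2 h3 h4
        simp only [RingHom.id_apply]
        rw [h1, h4, Pi.smul_apply, h2, h3, Pi.smul_apply] }
    ((ENNReal.ofReal |a⁻¹| ^ (1 / 2 : ℝ)).toReal) fun f => by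
      simp only [LinearMap.coe_mk, AddHom.coe_mk]
      rw [Lp.norm_toLp, eLpNorm_comp_const_mul ha (Lp.aestronglyMeasurable f), ENNReal.toReal_mul,
        Lp.norm_def]

theorem dilation_ae_eq {a : ℝ} (ha : a ≠ 0) (f : L2R) :
    dilation a ha f =ᵐ[volume] fun x => f (a * x) :=
  (memLp_comp_const_mul ha f).coeFn_toLp

theorem gaussQ_ae_eq (t : ℝ) (f : L2R) : gaussQ t f =ᵐ[volume] fun x => chirp t x * f x :=
  (memLp_chirp t f).coeFn_toLp

theorem chirp_zero (x : ℝ) : chirp 0 x = 1 := by simp [chirp]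

theorem chirp_mul (s t x : ℝ) : chirp s x * chirp t x = chirp (s + t) x := by
  unfold chirp
  rw [← Complex.exp_add]
  push_cast
  ring_nf

theorem gaussQ_gaussQ (s t : ℝ) (f : L2R) : gaussQ s (gaussQ t f) = gaussQ (s + t) f := by
  apply Lp.ext
  filter_upwards [gaussQ_ae_eq s (gaussQ t f), gaussQ_ae_eq t f, gaussQ_ae_eq (s + t) f]
    with x h1 h2 h3
  rw [h1, h2, h3, ← mul_assoc, chirp_mul]

theorem gaussQ_zero (f : L2R) : gaussQ 0 f = f := by
  apply Lp.ext
  filter_upwards [gaussQ_ae_eq 0 f] with x h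
  rw [h, chirp_zero, one_mul]

theorem dilation_one (f : L2R) : dilation 1 one_ne_zero f = f := by
  apply Lp.ext
  filter_upwards [dilation_ae_eq one_ne_zero f] with x h
  rw [h, one_mul]

theorem dilation_dilation {a b : ℝ} (ha : a ≠ 0) (hb : b ≠ 0) (f : L2R) :
    dilation a ha (dilation b hb f) = dilation (b * a) (mul_ne_zero hb ha) f := by
  apply Lp.ext
  filter_upwards [dilation_ae_eq ha (dilation b hb f),
    (quasiMeasurePreserving_const_mul ha).ae (dilation_ae_eq hb f),
    dilation_ae_eq (mul_ne_zero hb ha) f] with x h1 h2 h3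
  rw [h1, h2, h3, mul_assoc]

/-- The parity operator `f ↦ f(-·)`. -/
def parity : L2R →L[ℂ] L2R := dilation (-1) (by norm_num)

theorem parity_ae_eq (f : L2R) : parity f =ᵐ[volume] fun x => f (-x) := by
  filter_upwards [dilation_ae_eq (a := -1) (by norm_num) f] with x h
  rw [parity, h, neg_one_mul]

theorem parity_parity (f : L2R) : parity (parity f) = f := by
  rw [parity, dilation_dilation]
  apply Lp.ext
  filter_upwards [dilation_ae_eq (a := -1 * -1) (by norm_num) f] with x h
  rw [h]
  norm_num

theorem parity_dilation {a : ℝ} (ha : a ≠ 0) (f : L2R) :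
    parity (dilation a ha f) = dilation (-a) (neg_ne_zero.2 ha) f := by
  rw [parity, dilation_dilation]
  congr 2
  ring

theorem parity_gaussQ (t : ℝ) (f : L2R) : parity (gaussQ t f) = gaussQ t (parity f) := by
  apply Lp.ext
  filter_upwards [parity_ae_eq (gaussQ t f), gaussQ_ae_eq t (parity f), parity_ae_eq f,
    (Measure.measurePreserving_neg (volume : Measure ℝ)).quasiMeasurePreserving.ae
      (gaussQ_ae_eq t f)] with x h1 h2 h3 h4
  rw [h1, h2, h3, h4]
  simp [chirp]

/-! ### Parity and the inverse Fourier transform -/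

theorem denseRange_schwartz_toLp : DenseRange fun f : SchwartzMap ℝ ℂ => (f.toLp 2 : L2R) :=
  SchwartzMap.denseRange_toLpCLM (p := 2) ENNReal.ofNat_ne_top

theorem toMomentum_toLp (f : SchwartzMap ℝ ℂ) : toMomentum (f.toLp 2) = (𝓕 f).toLp 2 :=
  SchwartzMap.toLp_fourier_eq f

theorem toMomentum_symm_toLp (f : SchwartzMap ℝ ℂ) :
    toMomentum.symm (f.toLp 2) = (𝓕⁻ f).toLp 2 :=
  SchwartzMap.toLp_fourierInv_eq f

theorem eq_of_eq_on_schwartz {S T : L2R → L2R} (hS : Continuous S) (hT : Continuous T)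
    (h : ∀ f : SchwartzMap ℝ ℂ, S (f.toLp 2) = T (f.toLp 2)) (f : L2R) : S f = T f :=
  congrFun (denseRange_schwartz_toLp.equalizer hS hT (funext h)) f

theorem parity_toMomentum (f : L2R) : parity (toMomentum f) = toMomentum.symm f := by
  refine eq_of_eq_on_schwartz (S := fun f => parity (toMomentum f))
    (parity.continuous.comp toMomentum.continuous) toMomentum.symm.continuous (fun g => ?_) f
  rw [toMomentum_toLp, toMomentum_symm_toLp]
  apply Lp.ext
  filter_upwards [parity_ae_eq ((𝓕 g).toLp 2), (𝓕⁻ g).coeFn_toLp 2 volume,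
    (Measure.measurePreserving_neg (volume : Measure ℝ)).quasiMeasurePreserving.ae
      ((𝓕 g).coeFn_toLp 2 volume)] with x h1 h2 h3
  rw [h1, h2, h3, SchwartzMap.fourier_coe, SchwartzMap.fourierInv_coe,
    Real.fourierInv_eq_fourier_neg]

theorem parity_toMomentum_symm (f : L2R) : parity (toMomentum.symm f) = toMomentum f := by
  rw [← parity_toMomentum, parity_parity]

theorem toMomentum_toMomentum (f : L2R) : toMomentum (toMomentum f) = parity f := by
  rw [← parity_toMomentum_symm, toMomentum.symm_apply_apply]

theorem toMomentum_symm_symm (f : L2R) : toMomentum.symm (toMomentum.symm f) = parity f := by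
  rw [← parity_toMomentum, toMomentum.apply_symm_apply]

theorem toMomentum_parity (f : L2R) : toMomentum (parity f) = toMomentum.symm f := by
  rw [← toMomentum_symm_symm, toMomentum.apply_symm_apply]

theorem toMomentum_symm_parity (f : L2R) : toMomentum.symm (parity f) = toMomentum f := by
  rw [← toMomentum_toMomentum, toMomentum.symm_apply_apply]

theorem toMomentum_symm_ae_eq (f : L2R) (hf : Integrable f volume) :
    toMomentum.symm f =ᵐ[volume] 𝓕⁻ (f : ℝ → ℂ) := by
  rw [← parity_toMomentum]
  filter_upwards [parity_ae_eq (toMomentum f),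
    (Measure.measurePreserving_neg (volume : Measure ℝ)).quasiMeasurePreserving.ae
      (toMomentum_ae_eq f hf)] with x h1 h2
  rw [h1, h2, Real.fourierInv_eq_fourier_neg]

theorem fourierInv_eq_integral (f : ℝ → ℂ) (x : ℝ) :
    𝓕⁻ f x = ∫ y : ℝ, Complex.exp (2 * Real.pi * Complex.I * x * y) * f y := by
  rw [Real.fourierInv_eq']
  refine integral_congr_ae (Filter.Eventually.of_forall fun y => ?_)
  simp only [smul_eq_mul, RCLike.inner_apply, conj_trivial]
  congr 2
  push_cast
  ring

theorem fourier_eq_integral (f : ℝ → ℂ) (x : ℝ) :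
    𝓕 f x = ∫ y : ℝ, Complex.exp (-(2 * Real.pi * Complex.I * x * y)) * f y := by
  rw [Real.fourier_real_eq_integral_exp_smul]
  refine integral_congr_ae (Filter.Eventually.of_forall fun y => ?_)
  simp only [smul_eq_mul]
  congr 2
  push_cast
  ring

/-! ### The Fresnel integral -/

/-- The constant `(-it)^{-1/2}` in the kernel of `e^{πitp²}`. -/
def fresnelConst (t : ℝ) : ℂ := 1 / (-(t * Complex.I)) ^ (1 / 2 : ℂ)

theorem fresnelConst_ne_zero {t : ℝ} (ht : t ≠ 0) : fresnelConst t ≠ 0 := by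
  refine one_div_ne_zero fun h => ?_
  rw [Complex.cpow_eq_zero_iff] at h
  simp [ht] at h

theorem fresnelConst_one : fresnelConst 1 = Complex.exp (Real.pi * Complex.I / 4) := by
  have h : (-((1 : ℝ) * Complex.I)) ≠ 0 := by simp
  rw [fresnelConst, Complex.cpow_def_of_ne_zero h, one_div, ← Complex.exp_neg]
  congr 1
  rw [Complex.ofReal_one, one_mul, Complex.log_neg_I]
  ring

/-- The multiplication formula moves the Fourier transform onto the Gaussian, where it is explicit.
-/
theorem integral_fourier_mul_gaussian {f : ℝ → ℂ} (hf : Integrable f) {b : ℂ} (hb : 0 < b.re)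
    (x : ℝ) :
    ∫ ξ : ℝ, 𝓕 f ξ * Complex.exp (-Real.pi * b * ξ ^ 2 + 2 * Real.pi * (Complex.I * x) * ξ) =
      1 / b ^ (1 / 2 : ℂ) * ∫ y : ℝ, f y * Complex.exp (-Real.pi / b * (y - x) ^ 2) := by
  have hg : Integrable fun ξ : ℝ =>
      Complex.exp (-Real.pi * b * ξ ^ 2 + 2 * Real.pi * (Complex.I * x) * ξ) := by
    have h : 0 < (Real.pi * b).re := by
      rw [Complex.re_ofReal_mul]
      exact mul_pos Real.pi_pos hb
    simpa using integrable_cexp_quadratic h (2 * Real.pi * (Complex.I * x)) 0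
  rw [integral_mul_fourier _ _ hf hg, fourier_gaussian_pi' hb, ← integral_const_mul]
  refine integral_congr_ae (Filter.Eventually.of_forall fun y => ?_)
  have : Complex.I * (Complex.I * x) = -x := by
    rw [← mul_assoc, Complex.I_mul_I, neg_one_mul]
  simp only [this, ← sub_eq_add_neg]
  ring

open Filter Topology in
-- The boundary case `b = -it` of the Gaussian formula, where the Gaussian is no longer integrable.
-- It is the limit of `b = ε - it` as `ε → 0+`, by dominated convergence on both sides; this is why
-- both `f` and `𝓕 f` must be integrable.
theorem integral_fourier_mul_fresnel {f : ℝ → ℂ} (hf : Integrable f) (hf' : Integrable (𝓕 f))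
    {t : ℝ} (ht : t ≠ 0) (x : ℝ) :
    ∫ ξ : ℝ, 𝓕 f ξ *
        Complex.exp (-Real.pi * -(t * Complex.I) * ξ ^ 2 + 2 * Real.pi * (Complex.I * x) * ξ) =
      fresnelConst t *
        ∫ y : ℝ, f y * Complex.exp (-Real.pi / -(t * Complex.I) * (y - x) ^ 2) := by
  let b : ℝ → ℂ := fun ε => ε - t * Complex.I
  have hb : Tendsto b (𝓝[>] 0) (𝓝 (-(t * Complex.I))) := by
    have : Continuous b := by fun_prop
    simpa [b] using (this.tendsto 0).mono_left nhdsWithin_le_nhds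
  have hre (ε : ℝ) : (b ε).re = ε := by simp [b]
  have hne : -((t : ℂ) * Complex.I) ≠ 0 := by simp [ht]
  -- For `t ≠ 0` the limit point lies off the branch cut, so the principal square root is continuous
  -- there.
  have hslit : -((t : ℂ) * Complex.I) ∈ Complex.slitPlane := by
    right
    simp [ht]
  have hpos : ∀ᶠ ε : ℝ in 𝓝[>] 0, 0 < ε := eventually_mem_nhdsWithin
  have hleft : Tendsto (fun ε => ∫ ξ : ℝ, 𝓕 f ξ *
      Complex.exp (-Real.pi * b ε * ξ ^ 2 + 2 * Real.pi * (Complex.I * x) * ξ)) (𝓝[>] 0)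
      (𝓝 (∫ ξ : ℝ, 𝓕 f ξ * Complex.exp
        (-Real.pi * -(t * Complex.I) * ξ ^ 2 + 2 * Real.pi * (Complex.I * x) * ξ))) := by
    refine tendsto_integral_filter_of_dominated_convergence (fun ξ => ‖𝓕 f ξ‖) ?_ ?_ hf'.norm ?_
    · exact Eventually.of_forall fun ε => hf'.1.mul (by fun_prop)
    · filter_upwards [hpos] with ε hε
      refine Eventually.of_forall fun ξ => ?_
      rw [norm_mul, Complex.norm_exp]
      refine mul_le_of_le_one_right (norm_nonneg _) (Real.exp_le_one_iff.2 ?_)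
      have : (-Real.pi * b ε * ξ ^ 2 + 2 * Real.pi * (Complex.I * x) * ξ : ℂ).re =
          -(Real.pi * ε * ξ ^ 2) := by
        rw [← Complex.ofReal_pow]
        simp [hre, -Complex.ofReal_pow]
      rw [this]
      exact neg_nonpos.2 (by positivity)
    · refine Eventually.of_forall fun ξ => ?_
      have : Continuous fun z : ℂ => 𝓕 f ξ *
          Complex.exp (-Real.pi * z * ξ ^ 2 + 2 * Real.pi * (Complex.I * x) * ξ) := by fun_prop
      exact (this.tendsto _).comp hb
  have hright : Tendsto (fun ε => 1 / b ε ^ (1 / 2 : ℂ) *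
      ∫ y : ℝ, f y * Complex.exp (-Real.pi / b ε * (y - x) ^ 2)) (𝓝[>] 0)
      (𝓝 (fresnelConst t *
        ∫ y : ℝ, f y * Complex.exp (-Real.pi / -(t * Complex.I) * (y - x) ^ 2))) := by
    refine Tendsto.mul ?_ ?_
    · refine Tendsto.div tendsto_const_nhds ((continuousAt_cpow_const hslit).tendsto.comp hb) ?_
      simp [Complex.cpow_eq_zero_iff, ht]
    refine tendsto_integral_filter_of_dominated_convergence (fun y => ‖f y‖) ?_ ?_ hf.norm ?_
    · exact Eventually.of_forall fun ε => hf.1.mul (by fun_prop)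
    · filter_upwards [hpos] with ε hε
      refine Eventually.of_forall fun y => ?_
      rw [norm_mul, Complex.norm_exp]
      refine mul_le_of_le_one_right (norm_nonneg _) (Real.exp_le_one_iff.2 ?_)
      have : (-Real.pi / b ε * (y - x) ^ 2 : ℂ).re =
          -(Real.pi * (ε / Complex.normSq (b ε)) * (y - x) ^ 2) := by
        rw [← Complex.ofReal_sub, ← Complex.ofReal_pow, Complex.re_mul_ofReal, neg_div,
          Complex.neg_re, div_eq_mul_inv, Complex.re_ofReal_mul, Complex.inv_re, hre, neg_mul]
      rw [this]
      have := Complex.normSq_nonneg (b ε)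
      exact neg_nonpos.2 (by positivity)
    · refine Eventually.of_forall fun y => ?_
      exact tendsto_const_nhds.mul ((Complex.continuous_exp.tendsto _).comp
        ((tendsto_const_nhds.div hb hne).mul tendsto_const_nhds))
  refine tendsto_nhds_unique hleft (hright.congr' ?_)
  filter_upwards [hpos] with ε hε
  exact (integral_fourier_mul_gaussian hf (by rwa [hre]) x).symm

theorem integrable_gaussQ (t : ℝ) (f : L2R) (hf : Integrable f volume) :
    Integrable (gaussQ t f) volume := by
  refine (integrable_congr (gaussQ_ae_eq t f)).2 (hf.mono ?_ ?_)
  · exact (continuous_chirp t).aestronglyMeasurable.mul hf.1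
  · refine Filter.Eventually.of_forall fun x => ?_
    rw [norm_mul, norm_chirp, one_mul]

theorem integrable_toLp (f : SchwartzMap ℝ ℂ) : Integrable (f.toLp 2 : L2R) volume :=
  (integrable_congr (f.coeFn_toLp 2 volume)).2 f.integrable

theorem toMomentum_symm_gaussQ_ae_eq (t : ℝ) (f : L2R) (hf : Integrable f volume) :
    toMomentum.symm (gaussQ t f) =ᵐ[volume] fun x => ∫ y : ℝ,
      Complex.exp (2 * Real.pi * Complex.I * x * y) * (chirp t y * f y) := by
  filter_upwards [toMomentum_symm_ae_eq _ (integrable_gaussQ t f hf)] with x hx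
  rw [hx, fourierInv_eq_integral]
  refine integral_congr_ae ?_
  filter_upwards [gaussQ_ae_eq t f] with y hy
  rw [hy]

/-- The kernel of `e^{πitp²}` is `(-it)^{-1/2} e^{-πi(x-y)²/t}`. -/
theorem gaussP_eq {t : ℝ} (ht : t ≠ 0) (f : L2R) :
    toMomentum.symm (gaussQ t (toMomentum f)) = fresnelConst t • gaussQ (-t⁻¹)
      (dilation t⁻¹ (inv_ne_zero ht) (toMomentum.symm (gaussQ (-t⁻¹) f))) := by
  refine eq_of_eq_on_schwartz
    (S := fun f => toMomentum.symm (gaussQ t (toMomentum f)))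
    (T := fun f => fresnelConst t • gaussQ (-t⁻¹)
      (dilation t⁻¹ (inv_ne_zero ht) (toMomentum.symm (gaussQ (-t⁻¹) f))))
    (by fun_prop) (by fun_prop) (fun g => ?_) f
  rw [toMomentum_toLp]
  apply Lp.ext
  let h := dilation t⁻¹ (inv_ne_zero ht) (toMomentum.symm (gaussQ (-t⁻¹) (g.toLp 2)))
  filter_upwards [toMomentum_symm_gaussQ_ae_eq t _ (integrable_toLp (𝓕 g)),
    Lp.coeFn_smul (fresnelConst t) (gaussQ (-t⁻¹) h), gaussQ_ae_eq (-t⁻¹) h,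
    dilation_ae_eq (inv_ne_zero ht) (toMomentum.symm (gaussQ (-t⁻¹) (g.toLp 2))),
    (quasiMeasurePreserving_const_mul (inv_ne_zero ht)).ae
      (toMomentum_symm_gaussQ_ae_eq (-t⁻¹) _ (integrable_toLp g))] with x h1 h2 h3 h4 h5
  rw [h1, h2, Pi.smul_apply, h3, h4, h5]
  have hl : ∫ y : ℝ, Complex.exp (2 * Real.pi * Complex.I * x * y) *
      (chirp t y * ((𝓕 g).toLp 2 : L2R) y) = ∫ ξ : ℝ, 𝓕 (g : ℝ → ℂ) ξ *
        Complex.exp (-Real.pi * -(t * Complex.I) * ξ ^ 2 +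
          2 * Real.pi * (Complex.I * x) * ξ) := by
    refine integral_congr_ae ?_
    filter_upwards [(𝓕 g).coeFn_toLp 2 volume] with y hy
    rw [hy, SchwartzMap.fourier_coe, chirp, mul_comm (𝓕 (g : ℝ → ℂ) y), ← mul_assoc, ← Complex.exp_add]
    congr 2
    push_cast
    ring
  rw [hl, integral_fourier_mul_fresnel g.integrable (𝓕 g).integrable ht, smul_eq_mul]
  congr 1
  rw [← integral_const_mul]
  refine integral_congr_ae ?_
  filter_upwards [g.coeFn_toLp 2 volume] with y hy
  have ht' : (t : ℂ) ≠ 0 := by exact_mod_cast ht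
  rw [hy, mul_comm (g y), ← mul_assoc, ← mul_assoc, chirp, chirp, ← Complex.exp_add,
    ← Complex.exp_add]
  congr 2
  push_cast
  field_simp
  rw [Complex.I_sq]
  ring

/-! ### The operator `V` -/

theorem gaussP_one (f : L2R) : toMomentum.symm (gaussQ 1 (toMomentum f)) =
    fresnelConst 1 • gaussQ (-1) (toMomentum.symm (gaussQ (-1) f)) := by
  have h (g : L2R) : dilation (1 : ℝ)⁻¹ (inv_ne_zero one_ne_zero) g = g := by
    simpa only [inv_one] using dilation_one g
  rw [gaussP_eq one_ne_zero, h, inv_one]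

theorem toMomentum_symm_gaussQ_symm (f : L2R) :
    toMomentum.symm (gaussQ 1 (toMomentum.symm f)) =
      fresnelConst 1 • gaussQ (-1) (toMomentum (gaussQ (-1) f)) := by
  have h := gaussP_one (parity f)
  rwa [toMomentum_parity, ← parity_gaussQ, toMomentum_symm_parity] at h

/-- The constant `e^{-πi/12}`. -/
def phaseV : ℂ := Complex.exp (-(Real.pi * Complex.I / 12))

theorem phaseV_ne_zero : phaseV ≠ 0 := Complex.exp_ne_zero _

theorem gaussQ_neg_gaussQ (t : ℝ) (f : L2R) : gaussQ (-t) (gaussQ t f) = f := by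
  rw [gaussQ_gaussQ, neg_add_cancel, gaussQ_zero]

theorem gaussQ_gaussQ_neg (t : ℝ) (f : L2R) : gaussQ t (gaussQ (-t) f) = f := by
  rw [gaussQ_gaussQ, add_neg_cancel, gaussQ_zero]

/-- By `gaussP_one` the rightmost factor starts with `G (-1)`, which cancels `G 1`; then `𝓕 𝓕⁻¹`
cancels and `G 2` meets `G (-1)`. The phase is `-π/3 + π/4 = -π/12`. -/
theorem opV_apply (f : L2R) : opV f = phaseV • toMomentum.symm (gaussQ 1 f) := by
  have h : opV f = Complex.exp (-(Real.pi * Complex.I / 3)) • toMomentum.symm (gaussQ 2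
      (toMomentum (gaussQ 1 (toMomentum.symm (gaussQ 1 (toMomentum f)))))) := rfl
  rw [h, gaussP_one, map_smul, map_smul, gaussQ_gaussQ_neg, toMomentum.apply_symm_apply, map_smul,
    gaussQ_gaussQ, map_smul, smul_smul, fresnelConst_one, phaseV, ← Complex.exp_add]
  congr 2
  · ring
  · norm_num

/-- Replacing `𝓕⁻¹ (G 1) 𝓕⁻¹` by `e^{πi/4} (G (-1)) 𝓕 (G (-1))` in the cube makes all operators
cancel, and `3 · (-π/12) + π/4 = 0`. -/
theorem opV_opV_opV (f : L2R) : opV (opV (opV f)) = f := by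
  simp only [opV_apply, map_smul, smul_smul]
  rw [toMomentum_symm_gaussQ_symm, gaussQ_neg_gaussQ, toMomentum.apply_symm_apply,
    gaussQ_neg_gaussQ, smul_smul, fresnelConst_one, phaseV, ← Complex.exp_add, ← Complex.exp_add,
    ← Complex.exp_add]
  convert one_smul ℂ f
  rw [← Complex.exp_zero]
  congr 1
  ring

theorem opV_eq : opV = phaseV • ((gaussP 1 : L2R →L[ℂ] L2R) ∘L fourierOp) := by
  ext1 f
  have h : (phaseV • ((gaussP 1 : L2R →L[ℂ] L2R) ∘L fourierOp)) f =
    phaseV • toMomentum.symm (gaussQ 1 (toMomentum (toMomentum.symm f))) := rfl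
  rw [h, opV_apply, toMomentum.apply_symm_apply]

theorem norm_phaseV : ‖phaseV‖ = 1 := by
  rw [phaseV, Complex.norm_exp]
  simp

theorem opV_mem_unitary : opV ∈ unitary (L2R →L[ℂ] L2R) := by
  have h : opV = phaseV • (((gaussQ 1).trans toMomentum.symm : L2R ≃ₗᵢ[ℂ] L2R) : L2R →L[ℂ] L2R) :=
    ContinuousLinearMap.ext opV_apply
  have hc : phaseV ∈ unitary ℂ := by
    rw [Unitary.mem_iff_star_mul_self, RCLike.star_def, RCLike.conj_mul, norm_phaseV]
    simp
  rw [h]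
  exact Unitary.smul_mem_of_mem hc
    (Unitary.linearIsometryEquiv.symm ((gaussQ 1).trans toMomentum.symm)).2

theorem memLp_cexp_quadratic {b : ℂ} (hb : 0 < b.re) (c : ℂ) :
    MemLp (fun x : ℝ => Complex.exp (-Real.pi * b * x ^ 2 + 2 * Real.pi * c * x)) 2 volume := by
  have hm : Continuous fun x : ℝ =>
    Complex.exp (-Real.pi * b * x ^ 2 + 2 * Real.pi * c * x) := by fun_prop
  rw [memLp_two_iff_integrable_sq_norm hm.aestronglyMeasurable]
  have h : 0 < (2 * Real.pi * b).re := by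
    rw [← Complex.ofReal_ofNat, ← Complex.ofReal_mul, Complex.re_ofReal_mul]
    exact mul_pos Real.two_pi_pos hb
  have := (integrable_cexp_quadratic h (4 * Real.pi * c) 0).norm
  refine this.congr (Filter.Eventually.of_forall fun x => ?_)
  simp only [← norm_pow, ← Complex.exp_nat_mul]
  congr 2
  push_cast
  ring

theorem integrable_cexp_quadratic_pi {b : ℂ} (hb : 0 < b.re) (c : ℂ) :
    Integrable (fun x : ℝ => Complex.exp (-Real.pi * b * x ^ 2 + 2 * Real.pi * c * x)) := by
  have h : 0 < (Real.pi * b).re := by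
    rw [Complex.re_ofReal_mul]
    exact mul_pos Real.pi_pos hb
  simpa using integrable_cexp_quadratic h (2 * Real.pi * c) 0

theorem phaseV_ne_one : phaseV ≠ 1 := by
  intro h
  obtain ⟨n, hn⟩ := Complex.exp_eq_one_iff.1 h
  have hpi : (Real.pi : ℂ) ≠ 0 := by exact_mod_cast Real.pi_ne_zero
  -- Twelve times the equation `-πi/12 = 2πin`.
  have h1 : (Real.pi * Complex.I) * (24 * n + 1 : ℂ) = 0 := by linear_combination (-12) * hn
  have h2 : (24 * n + 1 : ℂ) = 0 :=
    (mul_eq_zero.1 h1).resolve_left (mul_ne_zero hpi Complex.I_ne_zero)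
  have h3 : 24 * n + 1 = 0 := by exact_mod_cast h2
  omega

theorem toMomentum_opV (f : L2R) : toMomentum (opV f) = phaseV • gaussQ 1 f := by
  rw [opV_apply, map_smul, toMomentum.apply_symm_apply]

theorem toMomentum_opV_ae_eq (f : L2R) :
    toMomentum (opV f) =ᵐ[volume] fun x => phaseV * (chirp 1 x * f x) := by
  rw [toMomentum_opV]
  filter_upwards [Lp.coeFn_smul phaseV (gaussQ 1 f), gaussQ_ae_eq 1 f] with x h1 h2
  rw [h1, Pi.smul_apply, h2, smul_eq_mul]

/-- Tested on `e^{-πx²}`, which the Fourier transform fixes: `V = 1` would give `phaseV * chirp 1 x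
* g x = g x`, which fails at `x = 0`. -/
theorem opV_ne_one : opV ≠ 1 := by
  intro h
  let g : ℝ → ℂ := fun x => Complex.exp (-Real.pi * 1 * x ^ 2 + 2 * Real.pi * 0 * x)
  have hg : MemLp g 2 volume := memLp_cexp_quadratic (by simp) 0
  have hgi : Integrable g := integrable_cexp_quadratic_pi (by simp) 0
  have hF : 𝓕 g = g := by
    rw [fourier_gaussian_pi' (by simp)]
    simp [g]
  have h1 := toMomentum_opV_ae_eq (hg.toLp g)
  rw [h] at h1
  have h2 : (fun x => phaseV * (chirp 1 x * g x)) =ᵐ[volume] g := by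
    filter_upwards [h1, hg.coeFn_toLp,
      toMomentum_ae_eq _ ((integrable_congr hg.coeFn_toLp).2 hgi)] with x h1 h2 h3
    rw [← h2, ← h1]
    exact h3.trans ((Real.fourier_congr_ae hg.coeFn_toLp x).trans ((congrFun hF x).trans h2.symm))
  have hc := continuous_chirp 1
  have h3 := congrFun ((Continuous.ae_eq_iff_eq volume (by fun_prop) (by fun_prop)).1 h2) 0
  exact phaseV_ne_one (by simpa [g, chirp] using h3)

theorem orderOf_opV : orderOf opV = 3 :=
  orderOf_eq_prime (ContinuousLinearMap.ext opV_opV_opV) opV_ne_one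

/-! ### Kernels of `F` and `V` -/

theorem hasIntegralKernel_of_phase {T : L2R →L[ℂ] L2R} {K : ℝ → ℝ → ℂ} (c : ℂ) (φ : ℝ → ℝ → ℝ)
    (hφ : ∀ x, Continuous (φ x)) (hK : ∀ x y, K x y = c * Complex.exp (φ x y * Complex.I))
    (h : ∀ f : L2R, Integrable f volume → ∀ᵐ x : ℝ, T f x = ∫ y, K x y * f y) :
    HasIntegralKernel T K := by
  intro f hf
  filter_upwards [h f hf] with x hx
  refine ⟨?_, hx⟩
  refine hf.bdd_mul (c := ‖c‖) ?_ (Filter.Eventually.of_forall fun y => ?_)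
  · have := hφ x
    rw [funext (hK x)]
    exact Continuous.aestronglyMeasurable (by fun_prop)
  · rw [hK, norm_mul, Complex.norm_exp_ofReal_mul_I, mul_one]

theorem fourierOp_kernel : HasIntegralKernel fourierOp
    (fun x y => Complex.exp (2 * Real.pi * Complex.I * x * y)) := by
  refine hasIntegralKernel_of_phase 1 (fun x y => 2 * Real.pi * x * y) (by fun_prop)
    (fun x y => ?_) fun f hf => ?_
  · rw [one_mul]
    push_cast
    ring_nf
  · filter_upwards [toMomentum_symm_ae_eq f hf] with x hx
    exact hx.trans (fourierInv_eq_integral _ _)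

theorem momMom_fourierOp : momMom fourierOp = fourierOp := by
  ext1 f
  exact toMomentum.apply_symm_apply _

theorem opV_kernel : HasIntegralKernel opV (fun x y => phaseV *
    Complex.exp (Real.pi * Complex.I * (2 * x + y) * y)) := by
  refine hasIntegralKernel_of_phase phaseV (fun x y => Real.pi * (2 * x + y) * y) (by fun_prop)
    (fun x y => ?_) fun f hf => ?_
  · push_cast
    ring_nf
  · filter_upwards [toMomentum_symm_gaussQ_ae_eq 1 f hf,
      Lp.coeFn_smul phaseV (toMomentum.symm (gaussQ 1 f))] with x h1 h2
    rw [opV_apply, h2, Pi.smul_apply, h1, smul_eq_mul, ← integral_const_mul]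
    refine integral_congr_ae (Filter.Eventually.of_forall fun y => ?_)
    simp only [chirp, ← mul_assoc]
    rw [mul_assoc phaseV, ← Complex.exp_add]
    push_cast
    ring_nf

theorem momMom_opV_kernel : HasIntegralKernel (momMom opV) (fun x y => phaseV *
    Complex.exp (Real.pi * Complex.I * (2 * y + x) * x)) := by
  refine hasIntegralKernel_of_phase phaseV (fun x y => Real.pi * (2 * y + x) * x) (by fun_prop)
    (fun x y => ?_) fun f hf => ?_
  · push_cast
    ring_nf
  · filter_upwards [toMomentum_opV_ae_eq (toMomentum.symm f),
      toMomentum_symm_ae_eq f hf] with x h1 h2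
    refine h1.trans ?_
    rw [h2, fourierInv_eq_integral, ← mul_assoc, ← integral_const_mul]
    refine integral_congr_ae (Filter.Eventually.of_forall fun y => ?_)
    simp only [chirp, ← mul_assoc]
    rw [mul_assoc phaseV, ← Complex.exp_add]
    push_cast
    ring_nf

theorem posMom_opV_kernel : HasIntegralKernel (posMom opV)
    (fun x y => Complex.exp (Real.pi * Complex.I / 6) *
      Complex.exp (-(Real.pi * Complex.I * (x + y) ^ 2))) := by
  refine hasIntegralKernel_of_phase (Complex.exp (Real.pi * Complex.I / 6))
    (fun x y => -(Real.pi * (x + y) ^ 2)) (by fun_prop) (fun x y => ?_) fun f hf => ?_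
  · push_cast
    ring_nf
  · have h : posMom opV f = Complex.exp (Real.pi * Complex.I / 6) •
        gaussQ (-1) (toMomentum (gaussQ (-1) f)) := by
      have h' : posMom opV f = opV (toMomentum.symm f) := rfl
      rw [h', opV_apply, toMomentum_symm_gaussQ_symm, smul_smul, fresnelConst_one, phaseV, ← Complex.exp_add]
      ring_nf
    rw [h]
    filter_upwards [Lp.coeFn_smul (Complex.exp (Real.pi * Complex.I / 6))
        (gaussQ (-1) (toMomentum (gaussQ (-1) f))),
      gaussQ_ae_eq (-1) (toMomentum (gaussQ (-1) f)),
      toMomentum_ae_eq _ (integrable_gaussQ (-1) f hf)] with x h1 h2 h3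
    rw [h1, Pi.smul_apply, h2, h3, smul_eq_mul, Real.fourier_congr_ae (gaussQ_ae_eq (-1) f),
      fourier_eq_integral, ← mul_assoc, ← integral_const_mul]
    refine integral_congr_ae (Filter.Eventually.of_forall fun y => ?_)
    simp only [chirp, ← mul_assoc]
    rw [mul_assoc, mul_assoc, ← mul_assoc _ _ (f y), ← mul_assoc _ _ (f y)]
    simp only [← Complex.exp_add]
    push_cast
    ring_nf

theorem momPos_opV_kernel : HasDiagonalKernel (momPos opV) (fun x => phaseV *
    Complex.exp (Real.pi * Complex.I * x ^ 2)) := by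
  intro f
  filter_upwards [toMomentum_opV_ae_eq f] with x hx
  refine hx.trans ?_
  rw [chirp]
  push_cast
  ring_nf

/-! ### Conjugation of `e^{aq+bp}` by `V` -/

theorem mem_graph_conjMul {U : L2R ≃ₗᵢ[ℂ] L2R} {φ : ℝ → ℂ} {f g : L2R} :
    (f, g) ∈ (conjMul U φ).graph ↔ U g =ᵐ[volume] fun x => φ x * U f x := by
  rw [LinearPMap.mem_graph_iff]
  constructor
  · rintro ⟨⟨f', hf'⟩, rfl, rfl⟩
    have h : U (conjMul U φ ⟨f', hf'⟩) = MemLp.toLp (fun x => φ x * U f' x) hf' :=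
      U.apply_symm_apply _
    simp only at h ⊢
    rw [h]
    exact MemLp.coeFn_toLp _
  · intro h
    have hf : MemLp (fun x => φ x * U f x) 2 volume := (memLp_congr_ae h).1 (Lp.memLp _)
    refine ⟨⟨f, hf⟩, rfl, ?_⟩
    refine (U.symm_apply_eq (x := MemLp.toLp _ hf)).2 (Lp.ext ?_)
    exact hf.coeFn_toLp.trans h.symm

theorem ae_comp_const_mul_iff {a : ℝ} (ha : a ≠ 0) {p : ℝ → Prop} :
    (∀ᵐ x, p (a * x)) ↔ ∀ᵐ x, p x := by
  refine ⟨fun h => ?_, fun h => (quasiMeasurePreserving_const_mul ha).ae h⟩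
  filter_upwards [(quasiMeasurePreserving_const_mul (inv_ne_zero ha)).ae h] with x hx
  rwa [mul_inv_cancel_left₀ ha] at hx

/-- In the two diagonalizing pictures `V` is a nowhere vanishing multiplier followed by a change of
variable: the multiplier cancels from the eigenvalue equation, and the dilation carries one symbol
to the other. -/
theorem mem_graph_conjMul_iff_of_intertwine {U U' : L2R ≃ₗᵢ[ℂ] L2R} {φ φ' : ℝ → ℂ}
    {V : L2R → L2R} {κ : ℂ} (hκ : κ ≠ 0) (s : ℝ) {a : ℝ} (ha : a ≠ 0)
    (hV : ∀ f, U' (V f) = κ • gaussQ s (dilation a ha (U f))) (hφ : ∀ x, φ' x = φ (a * x))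
    (f g : L2R) : (V f, V g) ∈ (conjMul U' φ').graph ↔ (f, g) ∈ (conjMul U φ).graph := by
  have h (f : L2R) : ∀ᵐ x, U' (V f) x = κ * (chirp s x * U f (a * x)) := by
    rw [hV]
    filter_upwards [Lp.coeFn_smul κ (gaussQ s (dilation a ha (U f))),
      gaussQ_ae_eq s (dilation a ha (U f)), dilation_ae_eq ha (U f)] with x h1 h2 h3
    rw [h1, Pi.smul_apply, h2, h3, smul_eq_mul]
  rw [mem_graph_conjMul, mem_graph_conjMul]
  refine Iff.trans ?_ (ae_comp_const_mul_iff ha)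
  refine Filter.eventually_congr ?_
  filter_upwards [h f, h g] with x hf hg
  have hc : chirp s x ≠ 0 := norm_ne_zero_iff.1 (by simp [norm_chirp])
  rw [hf, hg, hφ]
  refine ⟨fun h => mul_left_cancel₀ (mul_ne_zero hκ hc) ?_, fun h => ?_⟩
  · linear_combination h
  · linear_combination κ * chirp s x * h

/-- The formula for `𝓕⁻¹ (G s) 𝓕` conjugated by parity, which turns the dilation factor into its
negative. -/
theorem toMomentum_gaussQ_symm {s : ℝ} (hs : s ≠ 0) (f : L2R) :
    toMomentum (gaussQ s (toMomentum.symm f)) = fresnelConst s • gaussQ (-s⁻¹)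
      (dilation (-s⁻¹) (neg_ne_zero.2 (inv_ne_zero hs)) (toMomentum (gaussQ (-s⁻¹) f))) := by
  have h := congrArg parity (gaussP_eq hs (parity f))
  rw [toMomentum_parity, parity_toMomentum_symm, map_smul, ← parity_gaussQ,
    toMomentum_symm_parity, parity_gaussQ, parity_dilation] at h
  exact h

/-- The action `c ↦ c'` with `V (c.1 q + c.2 p) V⁻¹ = c'.1 q + c'.2 p`. -/
def heisRot (c : ℝ × ℝ) : ℝ × ℝ := (-c.2, c.1 - c.2)

theorem mem_graph_expHeis_heisRot {c : ℝ × ℝ} (hc : c ≠ 0) (f g : L2R) :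
    (opV f, opV g) ∈ (expHeis (heisRot c)).graph ↔ (f, g) ∈ (expHeis c).graph := by
  obtain ⟨a, b⟩ := c
  -- A multiple of `q` goes to a multiple of `p`: `𝓕 V = phaseV • G 1`.
  by_cases hb : b = 0
  · subst hb
    have ha : a ≠ 0 := fun h => hc (by rw [h]; rfl)
    refine mem_graph_conjMul_iff_of_intertwine phaseV_ne_zero 1 one_ne_zero (fun f => ?_)
      (fun x => ?_) f g
    · simp [heisUnitary, heisRot, ha, dilation_one, gaussQ_zero, toMomentum_opV]
    · simp [heisSymbol, heisRot, ha]
  -- A multiple of `q + p` goes to a multiple of `q`; here `V` is `phaseV` times parity after `𝓕 (G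
  -- 1)`.
  by_cases hab : a = b
  · subst hab
    refine mem_graph_conjMul_iff_of_intertwine phaseV_ne_zero 0
      (neg_ne_zero.2 one_ne_zero) (fun f => ?_) (fun x => ?_) f g
    · have h := parity_toMomentum (gaussQ 1 f)
      rw [parity] at h
      simp [heisUnitary, heisRot, hb, gaussQ_zero, opV_apply, h]
    · simp [heisSymbol, heisRot, hb]
  -- Generic case: both unitaries have the form `𝓕 (G t)`, and `s = -b / (a - b)` is the chirp
  -- parameter of the image.
  have hab' : a - b ≠ 0 := sub_ne_zero.2 hab
  have hs : -b / (a - b) ≠ 0 := div_ne_zero (neg_ne_zero.2 hb) hab'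
  refine mem_graph_conjMul_iff_of_intertwine
    (mul_ne_zero phaseV_ne_zero (fresnelConst_ne_zero hs)) (-(-b / (a - b))⁻¹)
    (neg_ne_zero.2 (inv_ne_zero hs)) (fun f => ?_) (fun x => ?_) f g
  · have h1 : heisUnitary (heisRot (a, b)) = (gaussQ (-b / (a - b))).trans toMomentum :=
      if_neg hab'
    have h2 : heisUnitary (a, b) = (gaussQ (a / b)).trans toMomentum := if_neg hb
    -- The chirp from the Fresnel formula and the one in `V` add up to the chirp that diagonalizes
    -- `aq + bp`.
    have h3 : -(-b / (a - b))⁻¹ + 1 = a / b := by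
      field_simp
      ring
    rw [h1, h2, LinearIsometryEquiv.trans_apply, LinearIsometryEquiv.trans_apply, opV_apply,
      map_smul, map_smul, toMomentum_gaussQ_symm hs, gaussQ_gaussQ, h3, smul_smul]
  · have h1 : heisSymbol (heisRot (a, b)) x = (a - b) * x := if_neg hab'
    have h2 (x : ℝ) : heisSymbol (a, b) x = b * x := if_neg hb
    rw [h1, h2]
    congr 2
    field_simp

theorem threeTerms_heisRot {b : ℝ} {x y : ℝ × ℝ} (h : IsRealization b x y) (i : Fin 3) :
    threeTerms 1 1 x y (i + 1) = heisRot (threeTerms 1 1 x y i) := by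
  rcases h with ⟨rfl, rfl⟩ | ⟨rfl, rfl⟩ <;> fin_cases i <;>
    simp [threeTerms, heisRot] <;> ring_nf <;> trivial

theorem threeTerms_ne_zero {b : ℝ} (hb : 0 < b) {x y : ℝ × ℝ} (h : IsRealization b x y)
    (i : Fin 3) : threeTerms 1 1 x y i ≠ 0 := by
  have hb' : 2 * Real.pi * b ≠ 0 := by positivity
  rcases h with ⟨rfl, rfl⟩ | ⟨rfl, rfl⟩ <;> fin_cases i <;>
    simp [threeTerms, hb.ne', Real.pi_ne_zero]
  intro h
  exact absurd (by linear_combination 3 * h) hb'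

theorem heisRot_smul (r : ℝ) (c : ℝ × ℝ) : heisRot (r • c) = r • heisRot c := by
  simp [heisRot, mul_sub]

/-- `V` maps the graph of each of the three operators onto that of the next. -/
def CyclesGraphs (V : L2R →L[ℂ] L2R) (A : Fin 3 → L2R →ₗ.[ℂ] L2R) : Prop :=
  ∀ i f g, (V f, V g) ∈ (A (i + 1)).graph ↔ (f, g) ∈ (A i).graph

theorem cyclesGraphs_expHeis {b : ℝ} (hb : 0 < b) {x y : ℝ × ℝ} (h : IsRealization b x y)
    {r : ℝ} (hr : r ≠ 0) :
    CyclesGraphs opV fun i => expHeis (r • threeTerms 1 1 x y i) := by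
  intro i f g
  beta_reduce
  rw [threeTerms_heisRot h, ← heisRot_smul]
  exact mem_graph_expHeis_heisRot (smul_ne_zero hr (threeTerms_ne_zero hb h i)) f g

/-! ### Form sums of closed operators -/

/-- Phrased through graphs, so that `CyclesGraphs` applies without transporting domain proofs. -/
theorem mem_formGraph {A : Fin 3 → L2R →ₗ.[ℂ] L2R} {f h : L2R} :
    (f, h) ∈ formGraph A ↔ ∃ a : Fin 3 → L2R, (∀ i, (f, a i) ∈ (A i).graph) ∧
      ∀ (g : L2R) (b : Fin 3 → L2R), (∀ i, (g, b i) ∈ (A i).graph) →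
        ∑ i, ⟪b i, a i⟫_ℂ = ⟪g, h⟫_ℂ := by
  constructor
  · rintro ⟨hf, hf'⟩
    refine ⟨fun i => A i ⟨f, hf i⟩, fun i => (A i).mem_graph ⟨f, hf i⟩, fun g b hb => ?_⟩
    have hg (i : Fin 3) : ∃ h : g ∈ (A i).domain, A i ⟨g, h⟩ = b i := by
      obtain ⟨y, hy, hy'⟩ := (A i).mem_graph_iff.1 (hb i)
      simp only at hy hy'
      subst hy
      exact ⟨y.2, hy'⟩
    choose hg hg' using hg
    simpa only [hg'] using hf' g hg
  · rintro ⟨a, ha, ha'⟩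
    have hf (i : Fin 3) : ∃ h : f ∈ (A i).domain, A i ⟨f, h⟩ = a i := by
      obtain ⟨y, hy, hy'⟩ := (A i).mem_graph_iff.1 (ha i)
      simp only at hy hy'
      subst hy
      exact ⟨y.2, hy'⟩
    choose hf hf' using hf
    refine ⟨hf, fun g hg => ?_⟩
    simpa only [hf'] using ha' g (fun i => A i ⟨g, hg i⟩) fun i => (A i).mem_graph ⟨g, hg i⟩

/-- Surjectivity of `1 + O`. The vectors `(f, A 0 f, A 1 f, A 2 f)` form a closed subspace `K`;
projecting `(h, 0, 0, 0)` onto `K` gives `f`, and orthogonality of the remainder to `K` is the weak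
form of `O f = h - f`. -/
theorem exists_mem_formGraph_sub {A : Fin 3 → L2R →ₗ.[ℂ] L2R} (hA : ∀ i, (A i).IsClosed)
    (h : L2R) : ∃ f, (f, h - f) ∈ formGraph A := by
  let E := PiLp 2 fun _ : Fin 4 => L2R
  let pr (i : Fin 3) : E →L[ℂ] L2R × L2R :=
    (PiLp.proj 2 (fun _ : Fin 4 => L2R) 0 : E →L[ℂ] L2R).prod
      (PiLp.proj 2 (fun _ : Fin 4 => L2R) i.succ)
  let K : Submodule ℂ E := ⨅ i, (A i).graph.comap (pr i).toLinearMap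
  have hmem (w : E) : w ∈ K ↔ ∀ i : Fin 3, (w 0, w i.succ) ∈ (A i).graph := by
    simp only [K, Submodule.mem_iInf]
    rfl
  have hK : IsClosed (K : Set E) := by
    have : (K : Set E) = ⋂ i, pr i ⁻¹' ((A i).graph : Set (L2R × L2R)) := by
      ext w
      simp only [K, Submodule.coe_iInf]
      rfl
    rw [this]
    exact isClosed_iInter fun i => (hA i).preimage (pr i).continuous
  have : CompleteSpace K := hK.completeSpace_coe
  let v : E := WithLp.toLp 2 (Fin.cons h fun _ => 0)
  let w : E := K.starProjection v
  have hw : w ∈ K := K.starProjection_apply_mem v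
  have horth (u : E) (hu : u ∈ K) : ⟪u, v - w⟫_ℂ = 0 :=
    (Submodule.mem_orthogonal K _).1 (K.sub_starProjection_mem_orthogonal v) u hu
  refine ⟨w 0, mem_formGraph.2 ⟨fun i => w i.succ, (hmem w).1 hw, fun g b hb => ?_⟩⟩
  have := horth (WithLp.toLp 2 (Fin.cons g b)) ((hmem _).2 hb)
  rw [PiLp.inner_apply, Fin.sum_univ_succ] at this
  have e0 : (v - w) 0 = h - w 0 := rfl
  have e1 (i : Fin 3) : (v - w) i.succ = -w i.succ := zero_sub _
  simp only [e0, e1, Fin.cons_zero, Fin.cons_succ, inner_neg_right,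
    Finset.sum_neg_distrib] at this
  linear_combination -this

/-- The form domain is total. -/
def FormDense (A : Fin 3 → L2R →ₗ.[ℂ] L2R) : Prop :=
  ∀ k : L2R, (∀ g, (∀ i, g ∈ (A i).domain) → ⟪g, k⟫_ℂ = 0) → k = 0

/-- Single-valuedness, needed for `toLinearPMap` to have `formGraph A` as its graph. -/
theorem formGraph_snd_eq_zero {A : Fin 3 → L2R →ₗ.[ℂ] L2R} (hA : FormDense A) (w : L2R × L2R)
    (hw : w ∈ formGraph A) (hw' : w.1 = 0) : w.2 = 0 := by
  obtain ⟨f, h⟩ := w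
  simp only at hw' ⊢
  subst hw'
  obtain ⟨a, ha, ha'⟩ := mem_formGraph.1 hw
  have ha0 (i : Fin 3) : a i = 0 := (A i).graph_fst_eq_zero_snd (ha i) rfl
  refine hA h fun g hg => ?_
  rw [← ha' g (fun i => A i ⟨g, hg i⟩) fun i => (A i).mem_graph ⟨g, hg i⟩]
  simp [ha0]

theorem formGraph_sum_norm_sq {A : Fin 3 → L2R →ₗ.[ℂ] L2R} {f h : L2R}
    (hf : (f, h) ∈ formGraph A) : ∃ a : Fin 3 → L2R, (∀ i, (f, a i) ∈ (A i).graph) ∧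
      ((∑ i, ‖a i‖ ^ 2 : ℝ) : ℂ) = ⟪f, h⟫_ℂ := by
  obtain ⟨a, ha, ha'⟩ := mem_formGraph.1 hf
  refine ⟨a, ha, ?_⟩
  rw [← ha' f a ha]
  push_cast
  exact Finset.sum_congr rfl fun i _ => (inner_self_eq_norm_sq_to_K (𝕜 := ℂ) (a i)).symm

/-- For `k` orthogonal to the domain, solve `(1 + O) f = k`. Then `0 = ⟪f, k⟫ = ‖f‖² + ∑ ‖A i f‖²`,
so `f = 0` and `k = O 0 = 0`. -/
theorem dense_domain_formGraph {A : Fin 3 → L2R →ₗ.[ℂ] L2R} (hA : ∀ i, (A i).IsClosed)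
    (hA' : FormDense A) : Dense ((formGraph A).toLinearPMap.domain : Set L2R) := by
  rw [Submodule.dense_iff_topologicalClosure_eq_top, Submodule.topologicalClosure_eq_top_iff,
    eq_bot_iff]
  intro k hk
  obtain ⟨f, hf⟩ := exists_mem_formGraph_sub hA k
  have hfd : f ∈ (formGraph A).toLinearPMap.domain := ⟨_, hf, rfl⟩
  have h0 : ⟪f, k⟫_ℂ = 0 := (Submodule.mem_orthogonal _ _).1 hk f hfd
  obtain ⟨a, ha, ha'⟩ := formGraph_sum_norm_sq hf
  rw [inner_sub_right, h0, zero_sub, inner_self_eq_norm_sq_to_K] at ha'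
  have h1 : (∑ i, ‖a i‖ ^ 2 : ℝ) = -‖f‖ ^ 2 := by
    apply Complex.ofReal_injective
    rw [ha']
    push_cast
    rfl
  have h2 : 0 ≤ (∑ i, ‖a i‖ ^ 2 : ℝ) := by positivity
  have hf0 : f = 0 := by
    rw [← norm_eq_zero, ← sq_eq_zero_iff]
    exact le_antisymm (by linarith) (sq_nonneg _)
  subst hf0
  simpa using formGraph_snd_eq_zero hA' _ hf rfl

theorem injective_formGraph {A : Fin 3 → L2R →ₗ.[ℂ] L2R} (hA : FormDense A)
    (h0 : ∀ f, (f, 0) ∈ (A 0).graph → f = 0) :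
    Function.Injective (formGraph A).toLinearPMap := by
  set T := (formGraph A).toLinearPMap with hT
  intro f g hfg
  have h : (((f - g : T.domain) : L2R), (0 : L2R)) ∈ formGraph A := by
    rw [← (formGraph A).toLinearPMap_graph_eq (formGraph_snd_eq_zero hA), ← hT]
    convert T.mem_graph (f - g)
    rw [T.map_sub, hfg, sub_self]
  obtain ⟨a, ha, ha'⟩ := formGraph_sum_norm_sq h
  rw [inner_zero_right] at ha'
  have h1 : (∑ i, ‖a i‖ ^ 2 : ℝ) = 0 := by exact_mod_cast ha'
  rw [Finset.sum_eq_zero_iff_of_nonneg fun i _ => by positivity] at h1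
  have h2 : a 0 = 0 := by simpa using h1 0 (Finset.mem_univ _)
  have h3 := h0 _ (h2 ▸ ha 0)
  exact sub_eq_zero.1 (Subtype.ext h3)

/-! ### Commutation -/

/-- Forward invariance of the graph suffices because `V⁻¹ = V²`. -/
theorem commutesWith_of_graph {V : L2R →L[ℂ] L2R} (hV : ∀ f, V (V (V f)) = f)
    {T : L2R →ₗ.[ℂ] L2R} (hT : ∀ f g, (f, g) ∈ T.graph → (V f, V g) ∈ T.graph) :
    CommutesWith V T := by
  have hdom (f : L2R) (hf : f ∈ T.domain) : V f ∈ T.domain :=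
    T.mem_domain_of_mem_graph (hT _ _ (T.mem_graph ⟨f, hf⟩))
  refine ⟨fun f => ⟨fun hf => ?_, hdom f⟩, fun f h => ?_⟩
  · rw [← hV f]
    exact hdom _ (hdom _ hf)
  · exact T.mem_graph_snd_inj' (T.mem_graph ⟨V f, h⟩) (hT _ _ (T.mem_graph f)) rfl

theorem commutesWith_inverse {V : L2R →L[ℂ] L2R} (hV : ∀ f, V (V (V f)) = f)
    {T : L2R →ₗ.[ℂ] L2R} (hT : ∀ f g, (f, g) ∈ T.graph → (V f, V g) ∈ T.graph)
    (hinj : Function.Injective T) : CommutesWith V T.inverse := by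
  refine commutesWith_of_graph hV fun f g hfg => ?_
  have hker : LinearMap.ker T.toFun = ⊥ := LinearMap.ker_eq_bot.2 hinj
  rw [LinearPMap.inverse_graph hker] at hfg ⊢
  obtain ⟨⟨a, b⟩, h, h'⟩ := hfg
  obtain ⟨rfl, rfl⟩ : b = f ∧ a = g := Prod.ext_iff.1 h'
  exact ⟨_, hT _ _ h, rfl⟩

/-- Move `V` to the test vector as `V⁻¹ = V²`, which shifts the indices back by one; the sum over
`Fin 3` is unchanged by the shift. -/
theorem formGraph_map {V : L2R →L[ℂ] L2R} (hV : ∀ f, V (V (V f)) = f)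
    (hV' : ∀ f g, ⟪V f, V g⟫_ℂ = ⟪f, g⟫_ℂ) {A : Fin 3 → L2R →ₗ.[ℂ] L2R} (hA : CyclesGraphs V A)
    {f h : L2R} (hf : (f, h) ∈ formGraph A) : (V f, V h) ∈ formGraph A := by
  obtain ⟨a, ha, ha'⟩ := mem_formGraph.1 hf
  refine mem_formGraph.2 ⟨fun i => V (a (i - 1)), fun i => ?_, fun g b hb => ?_⟩
  · simpa using (hA (i - 1) f (a (i - 1))).2 (ha _)
  · have hb' (i : Fin 3) : (V (V g), V (V (b (i + 1)))) ∈ (A i).graph := by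
      rw [← hA, hV, hV]
      exact hb _
    rw [← Equiv.sum_comp (Equiv.addRight 1)]
    calc ∑ i, ⟪b (i + 1), V (a (i + 1 - 1))⟫_ℂ
        = ∑ i, ⟪V (V (b (i + 1))), a i⟫_ℂ := Finset.sum_congr rfl fun i _ => by
          rw [← hV' (V (V (b (i + 1)))), hV, add_sub_cancel_right]
      _ = ⟪g, V h⟫_ℂ := by rw [ha' _ _ hb', ← hV' (V (V g)), hV]

theorem mem_graph_add {S T : L2R →ₗ.[ℂ] L2R} {f h : L2R} :
    (f, h) ∈ (S + T).graph ↔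
      ∃ a b, (f, a) ∈ S.graph ∧ (f, b) ∈ T.graph ∧ a + b = h := by
  constructor
  · intro hf
    obtain ⟨⟨f', h1, h2⟩, rfl, rfl⟩ := (S + T).mem_graph_iff.1 hf
    exact ⟨_, _, S.mem_graph ⟨f', h1⟩, T.mem_graph ⟨f', h2⟩, rfl⟩
  · rintro ⟨a, b, ha, hb, rfl⟩
    obtain ⟨⟨f1, h1⟩, hf1, rfl⟩ := S.mem_graph_iff.1 ha
    obtain ⟨⟨f2, h2⟩, hf2, rfl⟩ := T.mem_graph_iff.1 hb
    simp only at hf1 hf2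
    subst hf1 hf2
    exact (S + T).mem_graph ⟨f2, h1, h2⟩

theorem sum_graph_map {V : L2R →L[ℂ] L2R} {A : Fin 3 → L2R →ₗ.[ℂ] L2R} (hA : CyclesGraphs V A)
    {f h : L2R} (hf : (f, h) ∈ (A 0 + A 1 + A 2).graph) :
    (V f, V h) ∈ (A 0 + A 1 + A 2).graph := by
  simp only [mem_graph_add] at hf ⊢
  obtain ⟨_, c, ⟨a, b, ha, hb, rfl⟩, hc, rfl⟩ := hf
  refine ⟨_, _, ⟨_, _, (hA 2 _ _).2 hc, (hA 0 _ _).2 ha, rfl⟩, (hA 1 _ _).2 hb, ?_⟩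
  simp only [map_add]
  abel

/-! ### Closedness and domains of `e^{aq+bp}` -/

open Filter Topology in
-- Along a common subsequence both components converge almost everywhere, and the pointwise relation
-- passes to the limit.
theorem isClosed_conjMul (U : L2R ≃ₗᵢ[ℂ] L2R) (φ : ℝ → ℂ) : (conjMul U φ).IsClosed := by
  refine IsSeqClosed.isClosed fun p q hp hq => ?_
  have h1 : Tendsto (fun n => U (p n).1) atTop (𝓝 (U q.1)) :=
    ((U.continuous.comp continuous_fst).tendsto q).comp hq
  have h2 : Tendsto (fun n => U (p n).2) atTop (𝓝 (U q.2)) :=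
    ((U.continuous.comp continuous_snd).tendsto q).comp hq
  obtain ⟨ns, hns, hns'⟩ := (tendstoInMeasure_of_tendsto_Lp h1).exists_seq_tendsto_ae
  obtain ⟨ms, hms, hms'⟩ :=
    (tendstoInMeasure_of_tendsto_Lp (h2.comp hns.tendsto_atTop)).exists_seq_tendsto_ae
  refine mem_graph_conjMul.2 ?_
  have hp' : ∀ᵐ x, ∀ n, U (p n).2 x = φ x * U (p n).1 x :=
    ae_all_iff.2 fun n => mem_graph_conjMul.1 (hp n)
  filter_upwards [hns', hms', hp'] with x hx1 hx2 hx3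
  refine tendsto_nhds_unique hx2 ?_
  simp only [Function.comp_apply, hx3]
  exact (hx1.comp hms.tendsto_atTop).const_mul _

theorem eq_zero_of_mem_graph_conjMul {U : L2R ≃ₗᵢ[ℂ] L2R} {φ : ℝ → ℂ} (hφ : ∀ x, φ x ≠ 0)
    {f : L2R} (hf : (f, 0) ∈ (conjMul U φ).graph) : f = 0 := by
  rw [mem_graph_conjMul, map_zero] at hf
  refine (map_eq_zero_iff U U.injective).1 (Lp.ext ?_)
  filter_upwards [hf, Lp.coeFn_zero ℂ 2 (volume : Measure ℝ)] with x h1 h2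
  rw [h2, Pi.zero_apply] at h1 ⊢
  exact (mul_eq_zero.1 h1.symm).resolve_left (hφ x)

/-! ### Modulated Gaussians are total in the form domain -/

/-- The function `e^{-πx² + 2πiξx}`. -/
def gaussianWave (ξ x : ℝ) : ℂ :=
  Complex.exp (-Real.pi * 1 * x ^ 2 + 2 * Real.pi * (Complex.I * ξ) * x)

theorem memLp_gaussianWave (ξ : ℝ) : MemLp (gaussianWave ξ) 2 volume :=
  memLp_cexp_quadratic (by simp) _

theorem integrable_gaussianWave (ξ : ℝ) : Integrable (gaussianWave ξ) :=
  integrable_cexp_quadratic_pi (by simp) _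

/-- The vector `e^{-πx² + 2πiξx}` of `L²(ℝ)`. -/
def gaussianVec (ξ : ℝ) : L2R := (memLp_gaussianWave ξ).toLp _

theorem memLp_exp_mul {b : ℂ} (hb : 0 < b.re) (C c : ℂ) (r : ℝ) {f : ℝ → ℂ}
    (hf : f =ᵐ[volume] fun x =>
      C * Complex.exp (-Real.pi * b * x ^ 2 + 2 * Real.pi * c * x)) :
    MemLp (fun x => (Real.exp (r * x) : ℂ) * f x) 2 volume := by
  refine (memLp_congr_ae ?_).2
    ((memLp_cexp_quadratic hb (c + r / (2 * Real.pi))).const_mul C)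
  filter_upwards [hf] with x hx
  have hpi : (Real.pi : ℂ) ≠ 0 := by exact_mod_cast Real.pi_ne_zero
  rw [hx, Complex.ofReal_exp, mul_left_comm, ← Complex.exp_add]
  congr 2
  push_cast
  field_simp
  ring

/-- The chirp and the Fourier transform keep a Gaussian of complex width with positive real part in
this class (`b` goes to `b⁻¹`), and its decay beats any factor `e^{rx}`. -/
theorem gaussianVec_mem_domain (c : ℝ × ℝ) (ξ : ℝ) : gaussianVec ξ ∈ (expHeis c).domain := by
  change MemLp (fun x => (Real.exp (heisSymbol c x) : ℂ) * heisUnitary c (gaussianVec ξ) x) 2 volume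
  by_cases hc : c.2 = 0
  · simp only [heisSymbol, heisUnitary, if_pos hc]
    refine memLp_exp_mul (b := 1) (by simp) 1 (Complex.I * ξ) c.1 ?_
    filter_upwards [(memLp_gaussianWave ξ).coeFn_toLp] with x hx
    rw [one_mul]
    exact hx
  simp only [heisSymbol, heisUnitary, if_neg hc, LinearIsometryEquiv.trans_apply]
  set t := c.1 / c.2
  let b : ℂ := 1 - t * Complex.I
  have hb : 0 < b.re := by simp [b]
  have hb' : 0 < (b⁻¹).re := by
    rw [Complex.inv_re]
    exact div_pos hb (Complex.normSq_pos.2 fun h => by simp [h] at hb)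
  have hi : Integrable (gaussianVec ξ) volume :=
    (integrable_congr (memLp_gaussianWave ξ).coeFn_toLp).2 (integrable_gaussianWave ξ)
  refine memLp_exp_mul hb' (1 / b ^ (1 / 2 : ℂ) * Complex.exp (-Real.pi * b⁻¹ * ξ ^ 2)) (b⁻¹ * ξ)
    c.2 ?_
  have hG : gaussQ t (gaussianVec ξ) =ᵐ[volume] fun x : ℝ =>
      Complex.exp (-Real.pi * b * x ^ 2 + 2 * Real.pi * (Complex.I * ξ) * x) := by
    filter_upwards [gaussQ_ae_eq t (gaussianVec ξ), (memLp_gaussianWave ξ).coeFn_toLp]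
      with x h1 h2
    rw [h1, gaussianVec, h2, chirp, gaussianWave, ← Complex.exp_add]
    congr 1
    simp only [b]
    push_cast
    ring
  filter_upwards [toMomentum_ae_eq _ (integrable_gaussQ t _ hi)] with x hx
  rw [hx, Real.fourier_congr_ae hG, fourier_gaussian_pi' hb, mul_assoc, ← Complex.exp_add]
  have : Complex.I * (Complex.I * ξ) = -ξ := by
    rw [← mul_assoc, Complex.I_mul_I, neg_one_mul]
  rw [this, div_eq_mul_inv (-(Real.pi : ℂ))]
  beta_reduce
  congr 2
  ring

/-- The inner products are the values of the Fourier transform of `e^{-πx²} k`, so this product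
vanishes, and the Gaussian has no zeros. -/
theorem eq_zero_of_inner_gaussianVec (k : L2R) (hk : ∀ ξ, ⟪gaussianVec ξ, k⟫_ℂ = 0) : k = 0 := by
  have hm : MemLp (fun x => gaussianWave 0 x * k x) 2 volume := by
    refine (Lp.memLp k).of_le
      ((memLp_gaussianWave 0).1.mul (Lp.aestronglyMeasurable k))
      (Filter.Eventually.of_forall fun x => ?_)
    rw [norm_mul, gaussianWave, Complex.norm_exp]
    refine mul_le_of_le_one_left (norm_nonneg _) (Real.exp_le_one_iff.2 ?_)
    have : (-Real.pi * 1 * x ^ 2 + 2 * Real.pi * (Complex.I * (0 : ℝ)) * x : ℂ).re =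
        -(Real.pi * x ^ 2) := by
      rw [← Complex.ofReal_pow]
      simp [-Complex.ofReal_pow]
    rw [this]
    exact neg_nonpos.2 (by positivity)
  have hi : Integrable (fun x => gaussianWave 0 x * k x) :=
    (memLp_gaussianWave 0).integrable_mul (Lp.memLp k)
  have hF (ξ : ℝ) : 𝓕 (fun x => gaussianWave 0 x * k x) ξ = 0 := by
    rw [fourier_eq_integral, ← hk ξ, L2.inner_def]
    refine integral_congr_ae ?_
    filter_upwards [(memLp_gaussianWave ξ).coeFn_toLp] with x hx
    rw [gaussianVec, hx, RCLike.inner_apply', gaussianWave, gaussianWave,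
      ← Complex.exp_conj, ← mul_assoc, ← Complex.exp_add]
    congr 2
    simp [map_ofNat (starRingEnd ℂ) 2]
    ring
  have h0 : hm.toLp _ = 0 := by
    refine (map_eq_zero_iff toMomentum toMomentum.injective).1 (Lp.ext ?_)
    filter_upwards [toMomentum_ae_eq _ ((integrable_congr hm.coeFn_toLp).2 hi),
      Lp.coeFn_zero ℂ 2 (volume : Measure ℝ)] with x h1 h2
    rw [h1, h2, Real.fourier_congr_ae hm.coeFn_toLp, hF, Pi.zero_apply]
  refine Lp.ext ?_
  filter_upwards [hm.coeFn_toLp, Lp.coeFn_zero ℂ 2 (volume : Measure ℝ)] with x h1 h2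
  rw [h0, h2, Pi.zero_apply] at h1
  rw [h2, Pi.zero_apply]
  exact (mul_eq_zero.1 h1.symm).resolve_left (Complex.exp_ne_zero _)

theorem formDense_expHeis (c : Fin 3 → ℝ × ℝ) : FormDense fun i => expHeis (c i) :=
  fun k hk => eq_zero_of_inner_gaussianVec k fun ξ =>
    hk _ fun i => gaussianVec_mem_domain (c i) ξ

end

theorem mainTheorem6 :
    -- `V` is unitary, of order three, and equals `e^{-πi/12} e^{πip²} F`, where `F` is given by
    -- its kernels
    opV ∈ unitary (L2R →L[ℂ] L2R) ∧
    orderOf opV = 3 ∧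
    opV = Complex.exp (-(Real.pi * Complex.I / 12)) •
      ((gaussP 1 : L2R →L[ℂ] L2R) ∘L fourierOp) ∧
    HasIntegralKernel fourierOp
      (fun x y => Complex.exp (2 * Real.pi * Complex.I * x * y)) ∧
    HasIntegralKernel (momMom fourierOp)
      (fun x y => Complex.exp (2 * Real.pi * Complex.I * x * y)) ∧
    -- the kernels of `V`: `⟨x|V|y⟩`, `(x|V|y)`, `⟨x|V|y)` and `(x|V|y⟩`
    HasIntegralKernel opV (fun x y => Complex.exp (-(Real.pi * Complex.I / 12)) *
      Complex.exp (Real.pi * Complex.I * (2 * x + y) * y)) ∧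
    HasIntegralKernel (momMom opV) (fun x y => Complex.exp (-(Real.pi * Complex.I / 12)) *
      Complex.exp (Real.pi * Complex.I * (2 * y + x) * x)) ∧
    HasIntegralKernel (posMom opV) (fun x y => Complex.exp (Real.pi * Complex.I / 6) *
      Complex.exp (-(Real.pi * Complex.I * (x + y) ^ 2))) ∧
    HasDiagonalKernel (momPos opV) (fun x => Complex.exp (-(Real.pi * Complex.I / 12)) *
      Complex.exp (Real.pi * Complex.I * x ^ 2)) ∧
    -- `O_{1,1}` is densely defined and injective, and `V` commutes with `O_{1,1}` and with its
    -- inverse `ρ_{1,1}`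
    ∀ (b : ℝ), 0 < b → ∀ (x y : ℝ × ℝ), IsRealization b x y →
      Dense ((threeTermOp 1 1 x y).domain : Set L2R) ∧
      Function.Injective (threeTermOp 1 1 x y) ∧
      CommutesWith opV (threeTermSum 1 1 x y) ∧
      CommutesWith opV (threeTermOp 1 1 x y) ∧
      CommutesWith opV (rhoOp 1 1 x y) := by
  refine ⟨opV_mem_unitary, orderOf_opV, opV_eq, fourierOp_kernel,
    momMom_fourierOp.symm ▸ fourierOp_kernel, opV_kernel, momMom_opV_kernel, posMom_opV_kernel,
    momPos_opV_kernel, fun b hb x y h => ?_⟩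
  have hdense := formDense_expHeis fun i => (1 / 2 : ℝ) • threeTerms 1 1 x y i
  have hinj : Function.Injective (threeTermOp 1 1 x y) := injective_formGraph hdense fun f =>
    eq_zero_of_mem_graph_conjMul fun x => Complex.ofReal_ne_zero.2 (Real.exp_ne_zero _)
  have hgraph (f g : L2R) (hfg : (f, g) ∈ (threeTermOp 1 1 x y).graph) :
      (opV f, opV g) ∈ (threeTermOp 1 1 x y).graph := by
    rw [threeTermOp, Submodule.toLinearPMap_graph_eq _ (formGraph_snd_eq_zero hdense)] at hfg ⊢
    exact formGraph_map opV_opV_opV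
      (ContinuousLinearMap.inner_map_map_of_mem_unitary opV_mem_unitary)
      (cyclesGraphs_expHeis hb h (by norm_num)) hfg
  have hsum : CyclesGraphs opV fun i => expHeis (threeTerms 1 1 x y i) := by
    simpa only [one_smul] using cyclesGraphs_expHeis hb h one_ne_zero
  exact ⟨dense_domain_formGraph (fun i => isClosed_conjMul _ _) hdense, hinj,
    commutesWith_of_graph opV_opV_opV fun f g => sum_graph_map hsum,
    commutesWith_of_graph opV_opV_opV hgraph, commutesWith_inverse opV_opV_opV hgraph hinj⟩
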